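/- Let $M\ge 0$ be an integer, $D>0$, $k=2\pi/D$. Number the rows and columns of $(M+1)\times(M+1)$ matrices, and the components of vectors in $\mathbb C^{M+1}$, by $0,\dots,M$. Let $A$ be the symmetric tridiagonal matrix with zero diagonal and $A_{j-1,j}=A_{j,j-1}=\sqrt j$ $(1\le j\le M)$, let $B$ be the matrix whose only nonzero entries are $B_{j,j-1}=\sqrt j$ $(1\le j\le M)$, and let $G$ be the matrix whose only nonzero entry is $G_{1,0}=1$. Let $H=\mathrm{diag}(h_0,\dots,h_M)$ be real with $h_i\le 0$ for all $i$, $h_0=0$ and $h_M\neq 0$ (so that $M\ge 1$). Put $e_1=(1,0,\dots,0)^T$. Consider functions $\hat f^{(m)}:[0,\infty)\to\mathbb C^{M+1}$, $m\ge 0$, with $\hat f^{(0)}\equiv e_1$, $$\frac{d\hat f^{(1)}}{dt}+ i k\Big(A+\frac1{k^2}G\Big)\hat f^{(1)}=H\hat f^{(1)},\qquad \hat f^{(1)}(0)=e_1,$$ and, for all $m\ge 2$, $$\frac{d\hat f^{(m)}}{dt}+ i m k\Big(A+\frac1{(mk)^2}G\Big)\hat f^{(m)}+\frac{i}{k}\sum_{l=1}^{m-1}\frac1l\,\hat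 f^{(l)}_0\,B\hat f^{(m-l)}=H\hat f^{(m)},\qquad \hat f^{(m)}(0)=0.$$ Such functions exist. Moreover there are constants $\lambda^{(1)}>0$, $C^{(3)}>0$ and $\epsilon_0>0$, depending only on $M$, $D$ and $H$, such that for every integer $m\ne 0$ all the eigenvalues of the matrix $-imk\big(A+(mk)^{-2}G\big)+H$ have real part less than $-\lambda^{(1)}$, and such that, for all such functions $\hat f^{(m)}$, all real $\epsilon$ with $|\epsilon|<\epsilon_0$ and all $t\ge 0$, the series $$f(x,t)=\sum_{m=0}^{\infty}\epsilon^m\hat f^{(m)}(t)\,e^{imkx}$$ converges absolutely for every $x\in\mathbb R$, the function $f(\cdot,t)-\hat f^{(0)}$ is in $L^2([0,D];\mathbb C^{M+1})$, and $$\big\|f(\cdot,t)-\hat f^{(0)}\big\|_{L^2([0,D])}\le C^{(3)}\,(t^M+1)\,e^{-\lambda^{(1)}t},$$ where $\mathbb C^{M+1}$ carries the Euclidean norm. -/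

import Mathlib

open MeasureTheory Set

namespace FilteredVP

noncomputable section

/-- The vector space `ℂ^(M+1)` with the Euclidean norm; components are numbered `0, …, M`. -/
abbrev Vec (M : ℕ) : Type := EuclideanSpace ℂ (Fin (M + 1))

/-- The vector `(1, 0, …, 0)ᵀ`. -/
def e₁ (M : ℕ) : Vec M := EuclideanSpace.single 0 1

/-- The symmetric tridiagonal matrix with zero diagonal and off-diagonal entries
`√1, √2, …, √M`. -/
def matA (M : ℕ) : Matrix (Fin (M + 1)) (Fin (M + 1)) ℂ := Matrix.of fun i j =>
  if (i : ℕ) + 1 = j then ((Real.sqrt (j : ℕ) : ℝ) : ℂ)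
  else if (j : ℕ) + 1 = i then ((Real.sqrt (i : ℕ) : ℝ) : ℂ)
  else 0

/-- The matrix whose only nonzero entries are `√1, √2, …, √M` on the first subdiagonal. -/
def matB (M : ℕ) : Matrix (Fin (M + 1)) (Fin (M + 1)) ℂ := Matrix.of fun i j =>
  if (j : ℕ) + 1 = i then ((Real.sqrt (i : ℕ) : ℝ) : ℂ) else 0

/-- The matrix with a single nonzero entry, equal to `1`, in the second row and first column. -/
def matG (M : ℕ) : Matrix (Fin (M + 1)) (Fin (M + 1)) ℂ := Matrix.of fun i j =>
  if (i : ℕ) = 1 ∧ (j : ℕ) = 0 then 1 else 0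

/-- The filter matrix `diag(h₀, …, h_M)`. -/
def matH {M : ℕ} (h : Fin (M + 1) → ℝ) : Matrix (Fin (M + 1)) (Fin (M + 1)) ℂ :=
  Matrix.diagonal fun i => (h i : ℂ)

/-- A filter: non-positive diagonal entries, the first one zero and the last one nonzero. -/
structure IsFilter {M : ℕ} (h : Fin (M + 1) → ℝ) : Prop where
  nonpos : ∀ i, h i ≤ 0
  first : h 0 = 0
  last : h (Fin.last M) ≠ 0

/-- The wave number `k = 2π / D` of the period `D`. -/
def waveNumber (D : ℝ) : ℝ := 2 * Real.pi / D

/-- `G_m = - i m k (A + (m k)⁻² G) + H`. -/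
def matGm {M : ℕ} (h : Fin (M + 1) → ℝ) (k : ℝ) (m : ℤ) :
    Matrix (Fin (M + 1)) (Fin (M + 1)) ℂ :=
  -(Complex.I * m * k) • (matA M + (1 / ((m : ℂ) * k) ^ 2) • matG M) + matH h

/-- A matrix acting on a vector. -/
abbrev act {M : ℕ} (P : Matrix (Fin (M + 1)) (Fin (M + 1)) ℂ) (v : Vec M) : Vec M :=
  Matrix.toEuclideanCLM (n := Fin (M + 1)) (𝕜 := ℂ) P v

/-- The quadratic term `(i / k) ∑_{l=1}^{m-1} (1 / l) F_0^{(l)}(t) B F^{(m-l)}(t)`. -/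
def quadTerm {M : ℕ} (k : ℝ) (F : ℕ → ℝ → Vec M) (m : ℕ) (t : ℝ) : Vec M :=
  (Complex.I / k) • ∑ l ∈ Finset.Ico 1 m, ((1 / (l : ℂ)) * F l t 0) • act (matB M) (F (m - l) t)

/-- `F m t` is the `m`-th coefficient at time `t ≥ 0`: the coefficients solve the hierarchy obtained
by matching powers of `ε` in the filtered Hermite–Fourier system. -/
structure IsExpansion {M : ℕ} (h : Fin (M + 1) → ℝ) (k : ℝ) (F : ℕ → ℝ → Vec M) : Prop where
  zeroth : ∀ t, 0 ≤ t → F 0 t = e₁ M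
  first_init : F 1 0 = e₁ M
  first_order : ∀ t, 0 ≤ t → HasDerivWithinAt (F 1)
    (act (matH h) (F 1 t)
      - (Complex.I * k) • act (matA M + (1 / (k : ℂ) ^ 2) • matG M) (F 1 t)) (Ici 0) t
  high_init : ∀ m, 2 ≤ m → F m 0 = 0
  high_order : ∀ m, 2 ≤ m → ∀ t, 0 ≤ t → HasDerivWithinAt (F m)
    (act (matH h) (F m t)
      - (Complex.I * m * k) • act (matA M + (1 / ((m : ℂ) * k) ^ 2) • matG M) (F m t)
      - quadTerm k F m t) (Ici 0) t

/-- The `m`-th term `ε^m F^{(m)}(t) e^{i m k x}` of the series. -/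
def seriesTerm {M : ℕ} (k ε : ℝ) (F : ℕ → ℝ → Vec M) (x t : ℝ) (m : ℕ) : Vec M :=
  ((ε : ℂ) ^ m * Complex.exp (Complex.I * m * k * x)) • F m t

/-- The sum `f(x, t)` of the series. -/
def series {M : ℕ} (k ε : ℝ) (F : ℕ → ℝ → Vec M) (x t : ℝ) : Vec M :=
  ∑' m : ℕ, seriesTerm k ε F x t m

end

end FilteredVP

/-! The filter may damp only the top mode `M`, so decay of all modes is a hypocoercivity effect,
which a modified energy captures uniformly in the frequency `n = mk`. With weight `1 + 1/n²` on mode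
`0` the matrix `A + n⁻²G` is symmetric, so the weighted norm changes only through `H` and loses at
least a multiple of `‖x_M‖²`. Subtracting the terms `R^(2j²)/n · Im (x_j conj x_{j+1})` passes the
dissipation down from mode `j+1` to mode `j`: the derivative of each produces `R^(2j²)‖x_j‖²` plus
errors. Strict convexity of `j ↦ j²` makes each error smaller by a factor `1/R` than the sum of the
good terms, and the factor `1/n` cancels the size of the transport term. This is
`exists_uniform_energy`; an eigenvector inserted into it gives the spectral bound.

For the hierarchy, a source decaying at rate `λ` yields a solution decaying at rate `λ/2`
(`norm_le_of_forced`). The source is quadratic in coefficients of rate `λ/2`, hence has rate `λ`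
again, and the induction on `m` closes with no loss of rate and no polynomial factor. The constants
obey the Catalan recurrence, so they grow only geometrically (`exists_uniform_decay`), and the
series is dominated by a geometric series for small `ε`. -/

namespace FilteredVP

noncomputable section

/-! ### Coordinates extended by zero, and the generator in coordinates. -/

/-- The coefficients of a vector, extended by zero to all natural indices. -/
def coeffs {M : ℕ} (v : Vec M) (j : ℕ) : ℂ := if hj : j < M + 1 then v ⟨j, hj⟩ else 0

/-- The diagonal of the filter, extended by zero to all natural indices. -/
def extDiag {M : ℕ} (h : Fin (M + 1) → ℝ) (j : ℕ) : ℝ := if hj : j < M + 1 then h ⟨j, hj⟩ else 0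

/-- The subdiagonal entries of `A + n⁻² G`. -/
def subdiag (n : ℝ) (j : ℕ) : ℝ := (if j = 1 then 1 + 1 / n ^ 2 else 1) * √(j : ℝ)

/-- The weights that symmetrize `A + n⁻² G`. -/
def weight (n : ℝ) (j : ℕ) : ℝ := if j = 0 then 1 + 1 / n ^ 2 else 1

/-- The operator `H - i n (A + n⁻² G)`. -/
def generator {M : ℕ} (h : Fin (M + 1) → ℝ) (n : ℝ) (v : Vec M) : Vec M :=
  act (matH h) v - (Complex.I * n) • act (matA M + (1 / (n : ℂ) ^ 2) • matG M) v

theorem coeffs_of_lt {M : ℕ} (v : Vec M) {j : ℕ} (hj : j < M + 1) : coeffs v j = v ⟨j, hj⟩ :=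
  dif_pos hj

theorem coeffs_of_le {M : ℕ} (v : Vec M) {j : ℕ} (hj : M + 1 ≤ j) : coeffs v j = 0 :=
  dif_neg (by omega)

theorem coeffs_val {M : ℕ} (v : Vec M) (j : Fin (M + 1)) : coeffs v j = v j :=
  coeffs_of_lt v j.isLt

theorem coeffs_add {M : ℕ} (u v : Vec M) (j : ℕ) : coeffs (u + v) j = coeffs u j + coeffs v j := by
  unfold coeffs; split_ifs <;> simp

theorem coeffs_smul {M : ℕ} (z : ℂ) (v : Vec M) (j : ℕ) : coeffs (z • v) j = z * coeffs v j := by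
  unfold coeffs; split_ifs <;> simp

theorem norm_coeffs_le {M : ℕ} (v : Vec M) (j : ℕ) : ‖coeffs v j‖ ≤ ‖v‖ := by
  unfold coeffs; split_ifs
  · exact PiLp.norm_apply_le v _
  · simp

theorem sum_norm_coeffs_sq {M : ℕ} (v : Vec M) :
    ∑ j ∈ Finset.range (M + 1), ‖coeffs v j‖ ^ 2 = ‖v‖ ^ 2 := by
  rw [EuclideanSpace.norm_sq_eq, ← Fin.sum_univ_eq_sum_range (fun j => ‖coeffs v j‖ ^ 2)]
  simp only [coeffs_val]

/-- One formula covers both ends: at `j = 0` the truncated `j - 1` is harmless since `subdiag n 0 =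
0`, and at `j = M` the entry `M + 1` of the extension is zero. -/
theorem coeffs_generator {M : ℕ} (h : Fin (M + 1) → ℝ) (n : ℝ) (v : Vec M) {j : ℕ}
    (hj : j < M + 1) :
    coeffs (generator h n v) j = -(Complex.I * n) * ((subdiag n j : ℝ) * coeffs v (j - 1)
      + (√((j + 1 : ℕ) : ℝ) : ℝ) * coeffs v (j + 1)) + (extDiag h j : ℝ) * coeffs v j := by
  have hA : ∑ i : Fin (M + 1), matA M ⟨j, hj⟩ i * v i
      = (√(j : ℝ) : ℝ) * coeffs v (j - 1) + (√((j + 1 : ℕ) : ℝ) : ℝ) * coeffs v (j + 1) := by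
    have : ∀ i : Fin (M + 1), matA M ⟨j, hj⟩ i * v i
        = (if (i : ℕ) = j - 1 then (√(j : ℝ) : ℝ) * coeffs v i else 0)
          + (if (i : ℕ) = j + 1 then (√((j + 1 : ℕ) : ℝ) : ℝ) * coeffs v i else 0) := by
      intro i
      rw [coeffs_val]
      simp only [matA, Matrix.of_apply]
      rcases Nat.eq_zero_or_pos j with rfl | hjp
      · by_cases h1 : (i : ℕ) = 1
        · simp [h1]
        · simp [h1, Ne.symm h1]
      · by_cases h1 : (i : ℕ) = j + 1
        · rw [if_pos h1.symm, if_neg (by omega), if_pos h1, h1, zero_add]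
        · by_cases h2 : (i : ℕ) = j - 1
          · rw [if_neg (by omega), if_pos (by omega), if_pos h2, if_neg h1, add_zero]
          · rw [if_neg (by omega), if_neg (by omega), if_neg h2, if_neg h1, zero_mul, add_zero]
    rw [Finset.sum_congr rfl fun i _ => this i, Finset.sum_add_distrib,
      Fin.sum_univ_eq_sum_range
        (fun i => if i = j - 1 then ((√(j : ℝ) : ℝ) : ℂ) * coeffs v i else 0),
      Fin.sum_univ_eq_sum_range
        (fun i => if i = j + 1 then ((√((j + 1 : ℕ) : ℝ) : ℝ) : ℂ) * coeffs v i else 0),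
      Finset.sum_ite_eq', Finset.sum_ite_eq', if_pos (Finset.mem_range.2 (by omega))]
    congr 1
    split_ifs with h1
    · rfl
    · rw [coeffs_of_le v (by simpa using h1), mul_zero]
  have hG : ∑ i : Fin (M + 1), matG M ⟨j, hj⟩ i * v i = if j = 1 then coeffs v 0 else 0 := by
    rw [Fin.sum_univ_succ]
    simp [matG, coeffs]
  have hH : ∑ i : Fin (M + 1), matH h ⟨j, hj⟩ i * v i = (extDiag h j : ℝ) * coeffs v j := by
    rw [coeffs_of_lt v hj, extDiag, dif_pos hj]
    exact Matrix.mulVec_diagonal (fun i => (h i : ℂ)) v.ofLp ⟨j, hj⟩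
  rw [coeffs_of_lt _ hj]
  simp only [generator, PiLp.sub_apply, PiLp.smul_apply, Matrix.ofLp_toEuclideanCLM, act,
    Matrix.mulVec, dotProduct, Matrix.add_apply, Matrix.smul_apply, add_mul, smul_eq_mul,
    Finset.sum_add_distrib, mul_assoc, ← Finset.mul_sum]
  rw [hA, hG, hH, subdiag]
  split_ifs with h1
  · subst h1; simp; ring
  · push_cast; ring

theorem generator_eq_matGm {M : ℕ} (h : Fin (M + 1) → ℝ) (k : ℝ) (m : ℤ) (v : Vec M) :
    generator h (m * k) v = WithLp.toLp 2 (Matrix.toLin' (matGm h k m) v.ofLp) := by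
  ext i
  simp only [generator, matGm, PiLp.sub_apply, PiLp.smul_apply, Matrix.ofLp_toEuclideanCLM, act,
    Matrix.toLin'_apply, Matrix.add_mulVec, Matrix.smul_mulVec, Pi.add_apply, Pi.smul_apply]
  push_cast
  simp only [smul_eq_mul]
  ring

/-! ### The modified energy and its equivalence with the norm. -/

/-- The polarisation of the energy functional at `x` in direction `y`, i.e. its derivative along a
curve through `x` with velocity `y`. -/
def energyDeriv (M : ℕ) (N R n : ℝ) (x y : ℕ → ℂ) : ℝ :=
  N * ∑ j ∈ Finset.range (M + 1), weight n j * (2 * ((starRingEnd ℂ (x j)) * y j).re)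
    - ∑ j ∈ Finset.range M, R ^ (2 * j ^ 2) / n *
      (y j * starRingEnd ℂ (x (j + 1)) + x j * starRingEnd ℂ (y (j + 1))).im

/-- The modified energy. -/
def energy (M : ℕ) (N R n : ℝ) (x : ℕ → ℂ) : ℝ :=
  N * ∑ j ∈ Finset.range (M + 1), weight n j * ‖x j‖ ^ 2
    - ∑ j ∈ Finset.range M, R ^ (2 * j ^ 2) / n * (x j * starRingEnd ℂ (x (j + 1))).im

theorem energyDeriv_add (M : ℕ) (N R n : ℝ) (x y z : ℕ → ℂ) :
    energyDeriv M N R n x (fun j => y j + z j)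
      = energyDeriv M N R n x y + energyDeriv M N R n x z := by
  have h1 : ∀ j, weight n j * (2 * ((starRingEnd ℂ (x j)) * (y j + z j)).re)
      = weight n j * (2 * ((starRingEnd ℂ (x j)) * y j).re)
        + weight n j * (2 * ((starRingEnd ℂ (x j)) * z j).re) := by
    intro j; rw [mul_add, Complex.add_re]; ring
  have h2 : ∀ j, R ^ (2 * j ^ 2) / n *
      ((y j + z j) * starRingEnd ℂ (x (j + 1)) + x j * starRingEnd ℂ (y (j + 1) + z (j + 1))).im
      = R ^ (2 * j ^ 2) / n *
        (y j * starRingEnd ℂ (x (j + 1)) + x j * starRingEnd ℂ (y (j + 1))).im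
        + R ^ (2 * j ^ 2) / n *
        (z j * starRingEnd ℂ (x (j + 1)) + x j * starRingEnd ℂ (z (j + 1))).im := by
    intro j; rw [← mul_add, ← Complex.add_im, map_add]; congr 2; ring
  simp only [energyDeriv, h1, h2, Finset.sum_add_distrib]
  ring

/-- The energy is a Hermitian form, so the imaginary part of `z` only rotates the phase and drops
out. -/
theorem energyDeriv_mul (M : ℕ) (N R n : ℝ) (x : ℕ → ℂ) (z : ℂ) :
    energyDeriv M N R n x (fun j => z * x j) = 2 * z.re * energy M N R n x := by
  have h1 : ∀ j, weight n j * (2 * ((starRingEnd ℂ (x j)) * (z * x j)).re)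
      = 2 * z.re * (weight n j * ‖x j‖ ^ 2) := by
    intro j
    rw [← Complex.normSq_eq_norm_sq, Complex.normSq_apply]
    simp; ring
  have h2 : ∀ j, R ^ (2 * j ^ 2) / n *
      ((z * x j) * starRingEnd ℂ (x (j + 1)) + x j * starRingEnd ℂ (z * x (j + 1))).im
      = 2 * z.re * (R ^ (2 * j ^ 2) / n * (x j * starRingEnd ℂ (x (j + 1))).im) := by
    intro j; simp; ring
  simp only [energyDeriv, energy, h1, h2, ← Finset.mul_sum]
  ring

theorem one_le_weight (n : ℝ) (j : ℕ) : 1 ≤ weight n j := by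
  unfold weight; split_ifs
  · have : 0 ≤ 1 / n ^ 2 := by positivity
    linarith
  · exact le_rfl

theorem one_div_sq_le {k n : ℝ} (hk : 0 < k) (hn : k ≤ |n|) : 1 / n ^ 2 ≤ 1 / k ^ 2 := by
  rw [← sq_abs n]; gcongr

theorem weight_le {k n : ℝ} (hk : 0 < k) (hn : k ≤ |n|) (j : ℕ) :
    weight n j ≤ 1 + 1 / k ^ 2 := by
  have h1 := one_div_sq_le hk hn
  have h2 : 0 ≤ 1 / k ^ 2 := by positivity
  unfold weight; split_ifs <;> linarith

theorem abs_inv_coef_le {k n R : ℝ} (hk : 0 < k) (hn : k ≤ |n|) (hR : 1 ≤ R) {M j : ℕ}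
    (hj : j < M) : |R ^ (2 * j ^ 2) / n| ≤ R ^ (2 * M ^ 2) / k := by
  have hR0 : 0 ≤ R := by linarith
  rw [abs_div, abs_of_nonneg (by positivity)]
  gcongr

theorem abs_im_le {a : ℂ} {C : ℝ} (h : ‖a‖ ≤ C) : |a.im| ≤ C := (Complex.abs_im_le_norm a).trans h

theorem abs_re_le {a : ℂ} {C : ℝ} (h : ‖a‖ ≤ C) : |a.re| ≤ C := (Complex.abs_re_le_norm a).trans h

theorem abs_energyDeriv_le {k n R N X Y : ℝ} (hk : 0 < k) (hn : k ≤ |n|) (hR : 1 ≤ R) (hN : 0 ≤ N)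
    (M : ℕ) {x y : ℕ → ℂ} (hx : ∀ j, ‖x j‖ ≤ X) (hy : ∀ j, ‖y j‖ ≤ Y) :
    |energyDeriv M N R n x y| ≤
      2 * ((M + 1) * (N * (1 + 1 / k ^ 2) + R ^ (2 * M ^ 2) / k)) * (X * Y) := by
  have hX : 0 ≤ X := (norm_nonneg _).trans (hx 0)
  have hY : 0 ≤ Y := (norm_nonneg _).trans (hy 0)
  have hR0 : 0 ≤ R := by linarith
  have hP : 0 ≤ R ^ (2 * M ^ 2) / k := by positivity
  have h1 : |∑ j ∈ Finset.range (M + 1), weight n j * (2 * ((starRingEnd ℂ (x j)) * y j).re)|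
      ≤ (M + 1) * ((1 + 1 / k ^ 2) * (2 * (X * Y))) := by
    refine (Finset.abs_sum_le_sum_abs _ _).trans ((Finset.sum_le_card_nsmul _ _
      ((1 + 1 / k ^ 2) * (2 * (X * Y))) fun j _ => ?_).trans_eq ?_)
    · rw [abs_mul, abs_mul, abs_of_pos (one_pos.trans_le (one_le_weight n j)),
        abs_of_pos (two_pos)]
      have : |((starRingEnd ℂ (x j)) * y j).re| ≤ X * Y := abs_re_le (by
        rw [norm_mul, RCLike.norm_conj]
        exact mul_le_mul (hx j) (hy j) (norm_nonneg _) hX)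
      gcongr
      exact weight_le hk hn j
    · simp
  have h2 : |∑ j ∈ Finset.range M, R ^ (2 * j ^ 2) / n *
      (y j * starRingEnd ℂ (x (j + 1)) + x j * starRingEnd ℂ (y (j + 1))).im|
      ≤ M * (R ^ (2 * M ^ 2) / k * (2 * (X * Y))) := by
    refine (Finset.abs_sum_le_sum_abs _ _).trans ((Finset.sum_le_card_nsmul _ _
      (R ^ (2 * M ^ 2) / k * (2 * (X * Y))) fun j hj => ?_).trans_eq ?_)
    · rw [abs_mul]
      have : |(y j * starRingEnd ℂ (x (j + 1)) + x j * starRingEnd ℂ (y (j + 1))).im|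
          ≤ 2 * (X * Y) := abs_im_le (by
        refine (norm_add_le _ _).trans ?_
        rw [norm_mul, norm_mul, RCLike.norm_conj, RCLike.norm_conj]
        have := mul_le_mul (hy j) (hx (j + 1)) (norm_nonneg _) hY
        have := mul_le_mul (hx j) (hy (j + 1)) (norm_nonneg _) hX
        linarith)
      exact mul_le_mul (abs_inv_coef_le hk hn hR (Finset.mem_range.1 hj)) this (abs_nonneg _) hP
    · simp
  unfold energyDeriv
  refine (abs_sub _ _).trans ?_
  rw [abs_mul, abs_of_nonneg hN]
  have h3 := mul_le_mul_of_nonneg_left h1 hN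
  have h4 : 0 ≤ R ^ (2 * M ^ 2) / k * (2 * (X * Y)) := by positivity
  nlinarith

theorem energyDeriv_self (M : ℕ) (N R n : ℝ) (x : ℕ → ℂ) :
    energyDeriv M N R n x x = 2 * energy M N R n x := by
  simpa using energyDeriv_mul M N R n x 1

/-- Each of the `M` cross terms is at most `R^(2M²)/k` times the squared norm, so `N` leaves one
full copy of the squared norm over. -/
theorem sum_le_energy {k n R N : ℝ} (hk : 0 < k) (hn : k ≤ |n|) (hR : 1 ≤ R) (M : ℕ)
    (hN : 1 + M * (R ^ (2 * M ^ 2) / k) ≤ N) (x : ℕ → ℂ) :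
    ∑ j ∈ Finset.range (M + 1), ‖x j‖ ^ 2 ≤ energy M N R n x := by
  set S := ∑ j ∈ Finset.range (M + 1), ‖x j‖ ^ 2 with hS
  have hR0 : 0 ≤ R := by linarith
  have hP : 0 ≤ R ^ (2 * M ^ 2) / k := by positivity
  have hS0 : 0 ≤ S := by positivity
  have hxS : ∀ j ≤ M, ‖x j‖ ^ 2 ≤ S := fun j hj =>
    Finset.single_le_sum (f := fun j => ‖x j‖ ^ 2) (fun i _ => sq_nonneg _)
      (Finset.mem_range.2 (by omega))
  have h1 : S ≤ ∑ j ∈ Finset.range (M + 1), weight n j * ‖x j‖ ^ 2 :=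
    Finset.sum_le_sum fun j _ => le_mul_of_one_le_left (sq_nonneg _) (one_le_weight n j)
  have h2 : |∑ j ∈ Finset.range M, R ^ (2 * j ^ 2) / n * (x j * starRingEnd ℂ (x (j + 1))).im|
      ≤ M * (R ^ (2 * M ^ 2) / k * S) := by
    refine (Finset.abs_sum_le_sum_abs _ _).trans ((Finset.sum_le_card_nsmul _ _
      (R ^ (2 * M ^ 2) / k * S) fun j hj => ?_).trans_eq ?_)
    · have hj' := Finset.mem_range.1 hj
      rw [abs_mul]
      have : |(x j * starRingEnd ℂ (x (j + 1))).im| ≤ S := abs_im_le (by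
        rw [norm_mul, RCLike.norm_conj]
        nlinarith [hxS j hj'.le, hxS (j + 1) hj', sq_nonneg (‖x j‖ - ‖x (j + 1)‖)])
      exact mul_le_mul (abs_inv_coef_le hk hn hR hj') this (abs_nonneg _) hP
    · simp
  have hN1 : 0 ≤ N := by
    have : 0 ≤ M * (R ^ (2 * M ^ 2) / k) := by positivity
    linarith
  have h3 := mul_le_mul_of_nonneg_left h1 hN1
  have h4 := mul_le_mul_of_nonneg_right hN hS0
  have h5 := le_of_abs_le h2
  unfold energy
  nlinarith

theorem energy_le {k n R N X : ℝ} (hk : 0 < k) (hn : k ≤ |n|) (hR : 1 ≤ R) (hN : 0 ≤ N)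
    (M : ℕ) {x : ℕ → ℂ} (hx : ∀ j, ‖x j‖ ≤ X) :
    energy M N R n x ≤ ((M + 1) * (N * (1 + 1 / k ^ 2) + R ^ (2 * M ^ 2) / k)) * X ^ 2 := by
  have h1 := le_of_abs_le (abs_energyDeriv_le hk hn hR hN M hx hx)
  rw [energyDeriv_self] at h1
  nlinarith

/-! ### Dissipation of the modified energy. -/

/-- The generator on extended coefficient sequences. -/
def seqGenerator (H : ℕ → ℝ) (n : ℝ) (x : ℕ → ℂ) (j : ℕ) : ℂ :=
  -(Complex.I * n) * ((subdiag n j : ℝ) * x (j - 1) + (√((j + 1 : ℕ) : ℝ) : ℝ) * x (j + 1))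
    + (H j : ℝ) * x j

/-- Detailed balance: this is the symmetry of `A + n⁻²G` in the weighted inner product. -/
theorem weight_mul_sqrt_succ (n : ℝ) (j : ℕ) :
    weight n j * √((j + 1 : ℕ) : ℝ) = weight n (j + 1) * subdiag n (j + 1) := by
  rcases j with _ | j <;> simp [weight, subdiag]

/-- By symmetry the transport part is a difference of fluxes between neighbouring modes. It
telescopes, and the end fluxes vanish because `subdiag n 0 = 0` and `x (M + 1) = 0`. -/
theorem sum_weight_seqGenerator (H : ℕ → ℝ) (n : ℝ) (M : ℕ) {x : ℕ → ℂ} (hx : x (M + 1) = 0) :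
    ∑ j ∈ Finset.range (M + 1),
        weight n j * (2 * ((starRingEnd ℂ (x j)) * seqGenerator H n x j).re)
      = 2 * ∑ j ∈ Finset.range (M + 1), weight n j * (H j * ‖x j‖ ^ 2) := by
  set c : ℕ → ℝ := fun j =>
    2 * n * (weight n j * subdiag n j) * (starRingEnd ℂ (x j) * x (j - 1)).im with hc
  have h1 : ∀ j, weight n j * (2 * ((starRingEnd ℂ (x j)) * seqGenerator H n x j).re)
      = (c j - c (j + 1)) + 2 * (weight n j * (H j * ‖x j‖ ^ 2)) := by
    intro j
    simp only [hc, Nat.add_sub_cancel]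
    rw [← weight_mul_sqrt_succ, ← Complex.normSq_eq_norm_sq, Complex.normSq_apply, seqGenerator]
    simp
    ring
  rw [Finset.sum_congr rfl fun j _ => h1 j, Finset.sum_add_distrib, Finset.sum_range_sub',
    ← Finset.mul_sum]
  simp [hc, hx, subdiag]

/-- The term in `‖x j‖ ^ 2` is the dissipation gained; the other four are errors. Only the filter
term keeps a factor `1 / n`, which is bounded for `|n| ≥ k`. -/
theorem im_cross_seqGenerator (H : ℕ → ℝ) {n : ℝ} (hn : n ≠ 0) (x : ℕ → ℂ) (j : ℕ) :
    1 / n * (seqGenerator H n x j * starRingEnd ℂ (x (j + 1))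
        + x j * starRingEnd ℂ (seqGenerator H n x (j + 1))).im
      = subdiag n (j + 1) * ‖x j‖ ^ 2 - √((j + 1 : ℕ) : ℝ) * ‖x (j + 1)‖ ^ 2
        - subdiag n j * (x (j - 1) * starRingEnd ℂ (x (j + 1))).re
        + √((j + 1 + 1 : ℕ) : ℝ) * (x j * starRingEnd ℂ (x (j + 2))).re
        + (H j + H (j + 1)) / n * (x j * starRingEnd ℂ (x (j + 1))).im := by
  simp only [seqGenerator, ← Complex.normSq_eq_norm_sq, Complex.normSq_apply]
  simp
  field_simp
  ring

theorem one_le_subdiag_succ (n : ℝ) (j : ℕ) : 1 ≤ subdiag n (j + 1) := by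
  have h0 : subdiag n (j + 1) = weight n j * √((j + 1 : ℕ) : ℝ) := by
    rw [weight_mul_sqrt_succ]; simp [weight]
  rw [h0]
  have : 1 ≤ √((j + 1 : ℕ) : ℝ) := by
    rw [Real.one_le_sqrt]; exact_mod_cast Nat.succ_le_succ (Nat.zero_le j)
  nlinarith [one_le_weight n j]

theorem subdiag_nonneg (n : ℝ) (j : ℕ) : 0 ≤ subdiag n j := by
  unfold subdiag; split_ifs <;> positivity

theorem subdiag_le {k n : ℝ} (hk : 0 < k) (hn : k ≤ |n|) {j M : ℕ} (hj : j ≤ M) :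
    subdiag n j ≤ (1 + 1 / k ^ 2) * √((M + 1 : ℕ) : ℝ) := by
  have h1 := one_div_sq_le hk hn
  have h2 : 0 ≤ 1 / k ^ 2 := by positivity
  have h3 : 0 ≤ 1 / n ^ 2 := by positivity
  unfold subdiag
  refine mul_le_mul ?_ (Real.sqrt_le_sqrt (by exact_mod_cast hj.trans M.le_succ))
    (Real.sqrt_nonneg _) (by positivity)
  split_ifs <;> linarith

/-- The weighted moduli `R^(j²) |x_j|`. -/
def scaled (R : ℝ) (x : ℕ → ℂ) (j : ℕ) : ℝ := R ^ (j ^ 2) * ‖x j‖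

theorem pow_mul_le_scaled {R S : ℝ} (hR : 1 ≤ R) {x : ℕ → ℂ} {p a b : ℕ}
    (hp : p + 1 ≤ a ^ 2 + b ^ 2) (ha : scaled R x a ^ 2 ≤ S) (hb : scaled R x b ^ 2 ≤ S) :
    R ^ p * (‖x a‖ * ‖x b‖) ≤ S / R := by
  have hR0 : 0 < R := by linarith
  rw [le_div_iff₀ hR0]
  calc R ^ p * (‖x a‖ * ‖x b‖) * R = R ^ (p + 1) * (‖x a‖ * ‖x b‖) := by ring
    _ ≤ R ^ (a ^ 2 + b ^ 2) * (‖x a‖ * ‖x b‖) := by gcongr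
    _ = scaled R x a * scaled R x b := by unfold scaled; ring
    _ ≤ S := by nlinarith [sq_nonneg (scaled R x a - scaled R x b)]

/-- The error products pair the indices `(j+1, j+1)`, `(j-1, j+1)`, `(j, j+2)` and `(j, j+1)`. In
each case the squares of the indices sum to at least `2j² + 1`, so `pow_mul_le_scaled` gains `1/R`;
`L` bounds all coefficients. -/
theorem cross_lower_bound {k n R L : ℝ} (hk : 0 < k) (hn : k ≤ |n|) (hR : 1 ≤ R) {M : ℕ}
    (hL1 : (1 + 1 / k ^ 2) * √((M + 1 : ℕ) : ℝ) ≤ L) {H : ℕ → ℝ}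
    (hL2 : ∀ j, |H j + H (j + 1)| / k ≤ L) {x : ℕ → ℂ} (hx : x (M + 1) = 0) {S : ℝ}
    (hS : ∀ j ≤ M, scaled R x j ^ 2 ≤ S) {j : ℕ} (hj : j < M) :
    scaled R x j ^ 2 - 4 * (L * (S / R)) ≤ R ^ (2 * j ^ 2) / n *
      (seqGenerator H n x j * starRingEnd ℂ (x (j + 1))
        + x j * starRingEnd ℂ (seqGenerator H n x (j + 1))).im := by
  have hn0 : n ≠ 0 := by rintro rfl; simp at hn; linarith
  have hR0 : 0 < R := by linarith
  have hS0 : 0 ≤ S := (sq_nonneg _).trans (hS 0 (Nat.zero_le _))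
  have hSR : 0 ≤ S / R := by positivity
  have hP : 0 ≤ R ^ (2 * j ^ 2) := by positivity
  have hsqrt : ∀ i ≤ M + 1, √((i : ℕ) : ℝ) ≤ L := fun i hi => by
    refine le_trans ?_ hL1
    have h1 : √((i : ℕ) : ℝ) ≤ √((M + 1 : ℕ) : ℝ) := by gcongr
    have h2 : 0 ≤ 1 / k ^ 2 := by positivity
    nlinarith [Real.sqrt_nonneg ((M + 1 : ℕ) : ℝ)]
  have hL0 : 0 ≤ L := (Real.sqrt_nonneg _).trans (hsqrt 0 (Nat.zero_le _))
  have key : ∀ {c a r : ℝ}, |c| ≤ L → |r| ≤ a → R ^ (2 * j ^ 2) * a ≤ S / R →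
      |R ^ (2 * j ^ 2) * (c * r)| ≤ L * (S / R) := by
    intro c a r hc hr ha
    rw [abs_mul, abs_mul, abs_of_nonneg hP]
    calc R ^ (2 * j ^ 2) * (|c| * |r|) = |c| * (R ^ (2 * j ^ 2) * |r|) := by ring
      _ ≤ L * (R ^ (2 * j ^ 2) * a) := by gcongr
      _ ≤ L * (S / R) := by gcongr
  rw [div_eq_mul_one_div _ n, mul_assoc, im_cross_seqGenerator H hn0]
  have t1 : scaled R x j ^ 2 ≤ R ^ (2 * j ^ 2) * (subdiag n (j + 1) * ‖x j‖ ^ 2) := by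
    calc scaled R x j ^ 2 = R ^ (2 * j ^ 2) * (1 * ‖x j‖ ^ 2) := by unfold scaled; ring
      _ ≤ _ := by gcongr; exact one_le_subdiag_succ n j
  have t2 : |R ^ (2 * j ^ 2) * (√((j + 1 : ℕ) : ℝ) * ‖x (j + 1)‖ ^ 2)| ≤ L * (S / R) := by
    refine key (a := ‖x (j + 1)‖ * ‖x (j + 1)‖) ?_ (by rw [abs_of_nonneg (by positivity), sq]) ?_
    · rw [abs_of_nonneg (Real.sqrt_nonneg _)]; exact hsqrt _ (by omega)
    · exact pow_mul_le_scaled hR (by nlinarith) (hS _ hj) (hS _ hj)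
  have t3 : |R ^ (2 * j ^ 2) * (subdiag n j * (x (j - 1) * starRingEnd ℂ (x (j + 1))).re)|
      ≤ L * (S / R) := by
    rcases j with _ | i
    · simp [subdiag]; positivity
    · refine key (a := ‖x i‖ * ‖x (i + 1 + 1)‖) ?_ (abs_re_le (by simp)) ?_
      · rw [abs_of_nonneg (subdiag_nonneg _ _)]
        exact (subdiag_le hk hn hj.le).trans hL1
      · exact pow_mul_le_scaled hR (by nlinarith) (hS _ (by omega)) (hS _ hj)
  have t4 : |R ^ (2 * j ^ 2) * (√((j + 1 + 1 : ℕ) : ℝ) * (x j * starRingEnd ℂ (x (j + 2))).re)|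
      ≤ L * (S / R) := by
    refine key (a := ‖x j‖ * ‖x (j + 2)‖) ?_ (abs_re_le (by simp)) ?_
    · rw [abs_of_nonneg (Real.sqrt_nonneg _)]; exact hsqrt _ (by omega)
    -- For `j + 1 = M` the index `j + 2` lies beyond the last mode and the term vanishes.
    · rcases Nat.lt_or_ge (j + 1) M with h | h
      · exact pow_mul_le_scaled hR (by nlinarith) (hS _ hj.le) (hS _ h)
      · have : j + 2 = M + 1 := by omega
        rw [this, hx]; simpa using hSR
  have t5 : |R ^ (2 * j ^ 2) * ((H j + H (j + 1)) / n * (x j * starRingEnd ℂ (x (j + 1))).im)|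
      ≤ L * (S / R) := by
    refine key (a := ‖x j‖ * ‖x (j + 1)‖) ?_ (abs_im_le (by simp)) ?_
    · rw [abs_div]
      refine le_trans ?_ (hL2 j)
      gcongr
    · exact pow_mul_le_scaled hR (by nlinarith) (hS _ hj.le) (hS _ hj)
  have := abs_le.1 t2
  have := abs_le.1 t3
  have := abs_le.1 t4
  have := abs_le.1 t5
  rw [mul_add, mul_add, mul_sub, mul_sub]
  linarith

/-- The `4M` errors, each at most `L S / R`, use up half of `S` because `8ML ≤ R`. The cross terms
do not supply the summand `j = M` of `S`; the filter does, through `hHM`. -/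
theorem energyDeriv_seqGenerator_le {k n R L N : ℝ} (hk : 0 < k) (hn : k ≤ |n|) (hR : 1 ≤ R)
    {M : ℕ} (hL1 : (1 + 1 / k ^ 2) * √((M + 1 : ℕ) : ℝ) ≤ L) {H : ℕ → ℝ}
    (hL2 : ∀ j, |H j + H (j + 1)| / k ≤ L) (hRL : 8 * (M * L) ≤ R) (hH : ∀ j, H j ≤ 0)
    (hN : 0 ≤ N) (hHM : R ^ (2 * M ^ 2) ≤ N * (2 * -H M)) {x : ℕ → ℂ} (hx : x (M + 1) = 0) :
    energyDeriv M N R n x (seqGenerator H n x)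
      ≤ -(1 / 2) * ∑ j ∈ Finset.range (M + 1), ‖x j‖ ^ 2 := by
  have hR0 : 0 < R := by linarith
  set S := ∑ j ∈ Finset.range (M + 1), scaled R x j ^ 2 with hS
  have hS0 : 0 ≤ S := by positivity
  have hxS : ∀ j ≤ M, scaled R x j ^ 2 ≤ S := fun j hj =>
    Finset.single_le_sum (f := fun j => scaled R x j ^ 2) (fun i _ => sq_nonneg _)
      (Finset.mem_range.2 (by omega))
  have h1 := Finset.sum_le_sum fun j (hj : j ∈ Finset.range M) =>
    cross_lower_bound hk hn hR hL1 hL2 hx hxS (Finset.mem_range.1 hj)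
  rw [Finset.sum_sub_distrib, Finset.sum_const, Finset.card_range, nsmul_eq_mul] at h1
  have h2 : ∑ j ∈ Finset.range (M + 1), weight n j * (H j * ‖x j‖ ^ 2) ≤ H M * ‖x M‖ ^ 2 := by
    rw [Finset.sum_range_succ]
    have h3 : ∑ j ∈ Finset.range M, weight n j * (H j * ‖x j‖ ^ 2) ≤ 0 :=
      Finset.sum_nonpos fun j _ => mul_nonpos_of_nonneg_of_nonpos
        (zero_le_one.trans (one_le_weight n j))
        (mul_nonpos_of_nonpos_of_nonneg (hH j) (sq_nonneg _))
    have h4 : H M * ‖x M‖ ^ 2 ≤ 0 := mul_nonpos_of_nonpos_of_nonneg (hH M) (sq_nonneg _)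
    nlinarith [one_le_weight n M]
  have h3 : N * (2 * (H M * ‖x M‖ ^ 2)) ≤ -scaled R x M ^ 2 := by
    have := mul_le_mul_of_nonneg_right hHM (sq_nonneg ‖x M‖)
    have e : scaled R x M ^ 2 = R ^ (2 * M ^ 2) * ‖x M‖ ^ 2 := by unfold scaled; ring
    rw [e]; linarith
  have h4 : ∑ j ∈ Finset.range (M + 1), ‖x j‖ ^ 2 ≤ S := by
    refine Finset.sum_le_sum fun j _ => ?_
    have : 1 ≤ R ^ (j ^ 2) := one_le_pow₀ hR
    have : ‖x j‖ ≤ scaled R x j := le_mul_of_one_le_left (norm_nonneg _) this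
    gcongr
  have h5 : M * (4 * (L * (S / R))) ≤ S / 2 := by
    have : M * (4 * (L * (S / R))) = (8 * (M * L)) * (S / R) / 2 := by ring
    rw [this]
    have h6 : (8 * (M * L)) * (S / R) ≤ R * (S / R) := by gcongr
    rw [mul_div_cancel₀ _ hR0.ne'] at h6
    linarith
  have h6 : S = ∑ j ∈ Finset.range M, scaled R x j ^ 2 + scaled R x M ^ 2 := by
    rw [hS, Finset.sum_range_succ]
  unfold energyDeriv
  rw [sum_weight_seqGenerator H n M hx]
  have h7 : N * (2 * ∑ j ∈ Finset.range (M + 1), weight n j * (H j * ‖x j‖ ^ 2))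
      ≤ N * (2 * (H M * ‖x M‖ ^ 2)) := by gcongr
  linarith

theorem energyDeriv_congr {M : ℕ} (N R n : ℝ) (x : ℕ → ℂ) {y z : ℕ → ℂ}
    (hyz : ∀ j ≤ M, y j = z j) : energyDeriv M N R n x y = energyDeriv M N R n x z := by
  unfold energyDeriv
  congr 1
  · congr 1
    exact Finset.sum_congr rfl fun j hj => by rw [hyz j (by simpa [Nat.lt_succ_iff] using hj)]
  · refine Finset.sum_congr rfl fun j hj => ?_
    have := Finset.mem_range.1 hj
    rw [hyz j (by omega), hyz (j + 1) (by omega)]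

/-- The operators `H - i n (A + n⁻² G)`, `|n| ≥ k`, admit modified energies that are equivalent to
the norm and decay exponentially, all constants being independent of `n`. -/
theorem exists_uniform_energy {M : ℕ} {h : Fin (M + 1) → ℝ} (hh : IsFilter h) {k : ℝ}
    (hk : 0 < k) : ∃ N R lam C : ℝ, 0 < lam ∧ 1 ≤ C ∧ ∀ n : ℝ, k ≤ |n| → ∀ v : Vec M,
      ‖v‖ ^ 2 ≤ energy M N R n (coeffs v) ∧ energy M N R n (coeffs v) ≤ C * ‖v‖ ^ 2 ∧
      (∀ u : Vec M, |energyDeriv M N R n (coeffs v) (coeffs u)| ≤ 2 * C * (‖v‖ * ‖u‖)) ∧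
      energyDeriv M N R n (coeffs v) (coeffs (generator h n v))
        ≤ -(2 * lam) * energy M N R n (coeffs v) := by
  have hM : extDiag h M < 0 := by
    have : extDiag h M = h (Fin.last M) := dif_pos (Nat.lt_succ_self M)
    rw [this]
    exact lt_of_le_of_ne (hh.nonpos _) hh.last
  have hH : ∀ j, extDiag h j ≤ 0 := fun j => by
    unfold extDiag; split_ifs
    · exact hh.nonpos _
    · exact le_rfl
  obtain ⟨b, hb⟩ : ∃ b, ∀ j, |extDiag h j| ≤ b := by
    refine ⟨∑ i, |h i|, fun j => ?_⟩
    unfold extDiag; split_ifs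
    · exact Finset.single_le_sum (f := fun i => |h i|) (fun i _ => abs_nonneg _)
        (Finset.mem_univ _)
    · simpa using Finset.sum_nonneg fun i _ => abs_nonneg (h i)
  have hb0 : 0 ≤ b := (abs_nonneg _).trans (hb 0)
  set L := (1 + 1 / k ^ 2) * √((M + 1 : ℕ) : ℝ) + (b + b) / k with hL
  have hL1 : (1 + 1 / k ^ 2) * √((M + 1 : ℕ) : ℝ) ≤ L := le_add_of_nonneg_right (by positivity)
  have hL2 : ∀ j, |extDiag h j + extDiag h (j + 1)| / k ≤ L := fun j =>
    (div_le_div_of_nonneg_right ((abs_add_le _ _).trans (add_le_add (hb _) (hb _))) hk.le).trans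
      (le_add_of_nonneg_left (by positivity))
  set R := 1 + 8 * (M * L) with hR
  have hL0 : 0 ≤ L := by positivity
  have hR1 : 1 ≤ R := le_add_of_nonneg_right (by positivity)
  have hR0 : 0 < R := by linarith
  -- The first two summands give coercivity; the last lets the damping of mode `M` dominate
  -- `R^(2M²)`.
  set N := 1 + M * (R ^ (2 * M ^ 2) / k) + R ^ (2 * M ^ 2) / (2 * -extDiag h M) with hN
  have hden : 0 < 2 * -extDiag h M := by linarith
  have hN1 : 1 + M * (R ^ (2 * M ^ 2) / k) ≤ N := le_add_of_nonneg_right (by positivity)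
  have hN2 : 1 ≤ N := le_trans (le_add_of_nonneg_right (by positivity)) hN1
  have hN3 : R ^ (2 * M ^ 2) ≤ N * (2 * -extDiag h M) := by
    rw [← div_le_iff₀ hden]
    exact le_add_of_nonneg_left (by positivity)
  set C := (M + 1) * (N * (1 + 1 / k ^ 2) + R ^ (2 * M ^ 2) / k) with hC
  have hC1 : 1 ≤ C := by
    have h1 : 1 ≤ N * (1 + 1 / k ^ 2) := one_le_mul_of_one_le_of_one_le hN2
      (le_add_of_nonneg_right (by positivity))
    have h2 : 0 ≤ R ^ (2 * M ^ 2) / k := by positivity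
    have h3 : (0 : ℝ) ≤ M := Nat.cast_nonneg M
    nlinarith
  have hC0 : 0 < C := by linarith
  -- The energy loses at least `‖v‖²/2`, which is at least `1/(2C)` of the energy; hence `2λ =
  -- 1/(2C)`.
  refine ⟨N, R, 1 / (4 * C), C, by positivity, hC1, fun n hn v => ?_⟩
  have h1 := sum_le_energy hk hn hR1 M hN1 (coeffs v)
  rw [sum_norm_coeffs_sq] at h1
  have h2 := energy_le hk hn hR1 (by linarith) (N := N) M (norm_coeffs_le v)
  refine ⟨h1, h2, fun u => ?_, ?_⟩
  · exact abs_energyDeriv_le hk hn hR1 (by linarith) M (norm_coeffs_le v) (norm_coeffs_le u)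
  · rw [energyDeriv_congr N R n (coeffs v) fun j (hj : j ≤ M) =>
      coeffs_generator h n v (Nat.lt_succ_of_le hj)]
    refine (energyDeriv_seqGenerator_le hk hn hR1 hL1 hL2 (le_add_of_nonneg_left zero_le_one) hH
      (by linarith) hN3 (coeffs_of_le v le_rfl)).trans ?_
    rw [sum_norm_coeffs_sq]
    have : 2 * (1 / (4 * C)) * (C * ‖v‖ ^ 2) = 1 / 2 * ‖v‖ ^ 2 := by field_simp; norm_num
    have h3 := mul_le_mul_of_nonneg_left h2 (show 0 ≤ 2 * (1 / (4 * C)) by positivity)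
    rw [← hC, this] at h3
    linarith

/-! ### Decay of forced solutions, and eigenvalues. -/

theorem hasDerivWithinAt_coeffs {M : ℕ} {u : ℝ → Vec M} {u' : Vec M} {s : Set ℝ} {t : ℝ}
    (hu : HasDerivWithinAt u u' s t) (j : ℕ) :
    HasDerivWithinAt (fun r => coeffs (u r) j) (coeffs u' j) s t := by
  by_cases hj : j < M + 1
  · simp only [coeffs_of_lt _ hj]
    exact ((EuclideanSpace.proj (𝕜 := ℂ) (⟨j, hj⟩ : Fin (M + 1))).restrictScalars
      ℝ).hasFDerivAt.comp_hasDerivWithinAt t hu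
  · simp only [coeffs_of_le _ (not_lt.1 hj)]
    exact hasDerivWithinAt_const t s 0

theorem hasDerivWithinAt_energy {M : ℕ} (N R n : ℝ) {x : ℝ → ℕ → ℂ} {x' : ℕ → ℂ} {s : Set ℝ}
    {t : ℝ} (hx : ∀ j, HasDerivWithinAt (fun r => x r j) (x' j) s t) :
    HasDerivWithinAt (fun r => energy M N R n (x r)) (energyDeriv M N R n (x t) x') s t := by
  have hconj : ∀ j, HasDerivWithinAt (fun r => starRingEnd ℂ (x r j)) (starRingEnd ℂ (x' j)) s t :=
    fun j => Complex.conjCLE.toContinuousLinearMap.hasFDerivAt.comp_hasDerivWithinAt t (hx j)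
  have him : ∀ {f : ℝ → ℂ} {f' : ℂ}, HasDerivWithinAt f f' s t →
      HasDerivWithinAt (fun r => (f r).im) f'.im s t :=
    fun hf => Complex.imCLM.hasFDerivAt.comp_hasDerivWithinAt t hf
  have hre : ∀ {f : ℝ → ℂ} {f' : ℂ}, HasDerivWithinAt f f' s t →
      HasDerivWithinAt (fun r => (f r).re) f'.re s t :=
    fun hf => Complex.reCLM.hasFDerivAt.comp_hasDerivWithinAt t hf
  have hsq : ∀ j, HasDerivWithinAt (fun r => ‖x r j‖ ^ 2)
      (2 * (starRingEnd ℂ (x t j) * x' j).re) s t := by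
    intro j
    have h1 := hre ((hconj j).mul (hx j))
    have h2 : (fun r => ‖x r j‖ ^ 2) = fun r => (starRingEnd ℂ (x r j) * x r j).re := by
      funext r
      rw [← Complex.normSq_eq_norm_sq, Complex.normSq_apply]; simp
    rw [h2]
    refine h1.congr_deriv ?_
    rw [Complex.add_re]
    simp only [Complex.mul_re, Complex.conj_re, Complex.conj_im]
    ring
  unfold energy energyDeriv
  refine HasDerivWithinAt.sub (HasDerivWithinAt.const_mul _ (HasDerivWithinAt.fun_sum
    fun j _ => (hsq j).const_mul _)) (HasDerivWithinAt.fun_sum fun j _ =>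
      (him ((hx j).mul (hconj (j + 1)))).const_mul _)

/-- Young's inequality spends half of the energy decay rate `2λ` on the source. The energy then
decays at rate `λ`, the norm at rate `λ/2`. -/
theorem norm_le_of_forced {M : ℕ} {h : Fin (M + 1) → ℝ} {N R lam C n : ℝ} (hlam : 0 < lam)
    (hC : 1 ≤ C) (hE : ∀ v : Vec M, ‖v‖ ^ 2 ≤ energy M N R n (coeffs v) ∧
      energy M N R n (coeffs v) ≤ C * ‖v‖ ^ 2 ∧
      (∀ u : Vec M, |energyDeriv M N R n (coeffs v) (coeffs u)| ≤ 2 * C * (‖v‖ * ‖u‖)) ∧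
      energyDeriv M N R n (coeffs v) (coeffs (generator h n v))
        ≤ -(2 * lam) * energy M N R n (coeffs v)) {u g : ℝ → Vec M} {b : ℝ} (hb : 0 ≤ b)
    (hu : ∀ t, 0 ≤ t → HasDerivWithinAt u (generator h n (u t) + g t) (Ici 0) t)
    (hg : ∀ t, 0 ≤ t → ‖g t‖ ≤ b * Real.exp (-lam * t)) {t : ℝ} (ht : 0 ≤ t) :
    ‖u t‖ ≤ C * (‖u 0‖ + b / lam) * Real.exp (-(lam / 2) * t) := by
  -- The second summand has derivative `-(C²b²/λ) e^(-λr)`, exactly offsetting the source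
  -- contribution, so `φ` is nonincreasing.
  set φ : ℝ → ℝ := fun r => Real.exp (lam * r) * energy M N R n (coeffs (u r))
    + C ^ 2 * b ^ 2 / lam ^ 2 * Real.exp (-lam * r) with hφ
  have hd : ∀ r, 0 ≤ r → HasDerivWithinAt φ
      (Real.exp (lam * r) * lam * energy M N R n (coeffs (u r)) + Real.exp (lam * r) *
        energyDeriv M N R n (coeffs (u r)) (coeffs (generator h n (u r) + g r))
      + C ^ 2 * b ^ 2 / lam ^ 2 * (Real.exp (-lam * r) * -lam)) (Ici 0) r := by
    intro r hr
    have e1 : HasDerivAt (fun r => Real.exp (lam * r)) (Real.exp (lam * r) * lam) r := by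
      simpa using ((hasDerivAt_id r).const_mul lam).exp
    have e2 : HasDerivAt (fun r => Real.exp (-lam * r)) (Real.exp (-lam * r) * -lam) r := by
      simpa using ((hasDerivAt_id r).const_mul (-lam)).exp
    exact (e1.hasDerivWithinAt.mul (hasDerivWithinAt_energy N R n
      (hasDerivWithinAt_coeffs (hu r hr)))).add (e2.hasDerivWithinAt.const_mul _)
  have hle : ∀ r, 0 ≤ r → Real.exp (lam * r) * lam * energy M N R n (coeffs (u r))
      + Real.exp (lam * r) *
        energyDeriv M N R n (coeffs (u r)) (coeffs (generator h n (u r) + g r))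
      + C ^ 2 * b ^ 2 / lam ^ 2 * (Real.exp (-lam * r) * -lam) ≤ 0 := by
    intro r hr
    obtain ⟨h1, -, h3, h4⟩ := hE (u r)
    have h5 := le_of_abs_le (h3 (g r))
    have h6 : energyDeriv M N R n (coeffs (u r)) (coeffs (generator h n (u r) + g r))
        = energyDeriv M N R n (coeffs (u r)) (coeffs (generator h n (u r)))
          + energyDeriv M N R n (coeffs (u r)) (coeffs (g r)) := by
      rw [← energyDeriv_add]
      congr 1
      funext j
      exact coeffs_add _ _ j
    have h7 : 2 * C * (‖u r‖ * ‖g r‖) ≤ lam * ‖u r‖ ^ 2 + C ^ 2 * ‖g r‖ ^ 2 / lam := by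
      have : lam * ‖u r‖ ^ 2 + C ^ 2 * ‖g r‖ ^ 2 / lam - 2 * C * (‖u r‖ * ‖g r‖)
          = (lam * ‖u r‖ - C * ‖g r‖) ^ 2 / lam := by field_simp; ring
      have : 0 ≤ (lam * ‖u r‖ - C * ‖g r‖) ^ 2 / lam := by positivity
      linarith
    have h8 : C ^ 2 * ‖g r‖ ^ 2 / lam ≤ C ^ 2 * (b * Real.exp (-lam * r)) ^ 2 / lam := by
      have := hg r hr
      gcongr
    have h9 : lam * energy M N R n (coeffs (u r))
        + energyDeriv M N R n (coeffs (u r)) (coeffs (generator h n (u r) + g r))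
        ≤ C ^ 2 * (b * Real.exp (-lam * r)) ^ 2 / lam := by
      have := mul_le_mul_of_nonneg_left h1 hlam.le
      linarith
    have h10 := mul_le_mul_of_nonneg_left h9 (Real.exp_pos (lam * r)).le
    have h11 : Real.exp (lam * r) * (C ^ 2 * (b * Real.exp (-lam * r)) ^ 2 / lam)
        = C ^ 2 * b ^ 2 / lam ^ 2 * (Real.exp (-lam * r) * lam) := by
      have : Real.exp (lam * r) * Real.exp (-lam * r) = 1 := by
        rw [← Real.exp_add]; simp
      calc _ = C ^ 2 * b ^ 2 / lam * Real.exp (-lam * r)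
            * (Real.exp (lam * r) * Real.exp (-lam * r)) := by ring
        _ = _ := by rw [this]; field_simp
    linarith
  have hanti : AntitoneOn φ (Ici 0) := by
    refine antitoneOn_of_deriv_nonpos (convex_Ici 0) (fun r hr => (hd r hr).continuousWithinAt)
      (fun r hr => ?_) fun r hr => ?_
    · rw [interior_Ici] at hr ⊢
      exact ((hd r hr.le).mono Ioi_subset_Ici_self).differentiableWithinAt
    · rw [interior_Ici] at hr
      rw [((hd r hr.le).hasDerivAt (Ici_mem_nhds hr)).deriv]
      exact hle r hr.le
  have h0 := hanti (mem_Ici.2 le_rfl) (mem_Ici.2 ht) ht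
  simp only [hφ, mul_zero, Real.exp_zero, one_mul, mul_one] at h0
  have hE0 := (hE (u 0)).2.1
  have hEt := (hE (u t)).1
  have h1 : Real.exp (lam * t) * ‖u t‖ ^ 2 ≤ (C * (‖u 0‖ + b / lam)) ^ 2 := by
    have i1 : Real.exp (lam * t) * ‖u t‖ ^ 2 ≤ Real.exp (lam * t) * energy M N R n (coeffs (u t)) :=
      by gcongr
    have i2 : 0 ≤ C ^ 2 * b ^ 2 / lam ^ 2 * Real.exp (-lam * t) := by positivity
    have i3 : (C * (‖u 0‖ + b / lam)) ^ 2 = C ^ 2 * ‖u 0‖ ^ 2 + C ^ 2 * b ^ 2 / lam ^ 2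
        + 2 * C ^ 2 * ‖u 0‖ * (b / lam) := by field_simp; ring
    have i4 : 0 ≤ 2 * C ^ 2 * ‖u 0‖ * (b / lam) := by positivity
    have i5 : C * ‖u 0‖ ^ 2 ≤ C ^ 2 * ‖u 0‖ ^ 2 := by
      gcongr; nlinarith
    linarith
  have h2 : 0 ≤ C * (‖u 0‖ + b / lam) := by positivity
  have h3 : (Real.exp (lam / 2 * t) * ‖u t‖) ^ 2 ≤ (C * (‖u 0‖ + b / lam)) ^ 2 := by
    rw [mul_pow, ← Real.exp_nat_mul]
    convert h1 using 3
    push_cast; ring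
  have h4 := le_of_sq_le_sq h3 h2
  have h5 : Real.exp (lam / 2 * t) * Real.exp (-(lam / 2) * t) = 1 := by
    rw [← Real.exp_add]; simp
  calc ‖u t‖ = (Real.exp (lam / 2 * t) * ‖u t‖) * Real.exp (-(lam / 2) * t) := by
        rw [mul_right_comm, h5, one_mul]
    _ ≤ _ := by gcongr

/-- On an eigenvector the energy derivative is `2 Re z` times the energy, which is positive. -/
theorem eigenvalue_re_le {M : ℕ} {h : Fin (M + 1) → ℝ} {N R lam C k : ℝ} {m : ℤ}
    (hE : ∀ v : Vec M, ‖v‖ ^ 2 ≤ energy M N R (m * k) (coeffs v) ∧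
      energy M N R (m * k) (coeffs v) ≤ C * ‖v‖ ^ 2 ∧
      (∀ u : Vec M, |energyDeriv M N R (m * k) (coeffs v) (coeffs u)| ≤ 2 * C * (‖v‖ * ‖u‖)) ∧
      energyDeriv M N R (m * k) (coeffs v) (coeffs (generator h (m * k) v))
        ≤ -(2 * lam) * energy M N R (m * k) (coeffs v)) {z : ℂ}
    (hz : Module.End.HasEigenvalue (Matrix.toLin' (matGm h k m)) z) : z.re ≤ -lam := by
  obtain ⟨w, hw⟩ := hz.exists_hasEigenvector
  set v : Vec M := WithLp.toLp 2 w with hv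
  have hv0 : v ≠ 0 := fun h0 => hw.2 (by simpa [hv] using h0)
  obtain ⟨h1, -, -, h4⟩ := hE v
  have hgen : generator h (m * k) v = z • v := by
    rw [generator_eq_matGm, hv]
    simp only [hw.apply_eq_smul]
    rfl
  have hpos : 0 < energy M N R (m * k) (coeffs v) :=
    lt_of_lt_of_le (by have := norm_pos_iff.2 hv0; positivity) h1
  rw [hgen, show coeffs (z • v) = fun j => z * coeffs v j from funext fun j => coeffs_smul z v j,
    energyDeriv_mul] at h4
  have := le_of_mul_le_mul_right h4 hpos
  linarith

/-! ### Existence of the coefficients. -/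

/-- Duhamel's formula with the operator exponential. -/
theorem exists_linear_ode_solution {E : Type*} [NormedAddCommGroup E] [NormedSpace ℝ E]
    [CompleteSpace E] (P : E →L[ℝ] E) (v₀ : E) (g : C(ℝ, E)) :
    ∃ u : C(ℝ, E), u 0 = v₀ ∧ ∀ t, HasDerivAt u (P (u t) + g t) t := by
  have hexp : ∀ t : ℝ, HasDerivAt (fun s : ℝ => NormedSpace.exp (s • P))
      (P * NormedSpace.exp (t • P)) t := fun t => hasDerivAt_exp_smul_const' P t
  have hcont : Continuous fun s : ℝ => NormedSpace.exp (s • P) :=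
    continuous_iff_continuousAt.2 fun t => (hexp t).continuousAt
  have hint : Continuous fun s : ℝ => NormedSpace.exp ((-s) • P) (g s) :=
    (hcont.comp continuous_neg).clm_apply g.continuous
  set w : ℝ → E := fun t => v₀ + ∫ s in (0 : ℝ)..t, NormedSpace.exp ((-s) • P) (g s) with hw
  have hw' : ∀ t, HasDerivAt w (NormedSpace.exp ((-t) • P) (g t)) t := fun t =>
    (intervalIntegral.integral_hasDerivAt_right (hint.intervalIntegrable _ _)
      (hint.stronglyMeasurableAtFilter _ _) hint.continuousAt).const_add v₀
  have hinv : ∀ t : ℝ, NormedSpace.exp (t • P) * NormedSpace.exp ((-t) • P) = 1 := by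
    intro t
    let : NormedAlgebra ℚ (E →L[ℝ] E) := NormedAlgebra.restrictScalars ℚ ℝ _
    have hc : Commute (t • P) ((-t) • P) := ((Commute.refl P).smul_left t).smul_right (-t)
    rw [← NormedSpace.exp_add_of_commute hc]
    simp
  have hu : ∀ t, HasDerivAt (fun s => NormedSpace.exp (s • P) (w s))
      (P (NormedSpace.exp (t • P) (w t)) + g t) t := by
    intro t
    have := (hexp t).clm_apply (hw' t)
    rwa [← mul_apply_eq_comp, hinv, one_apply_eq_self,
      mul_apply_eq_comp] at this
  refine ⟨⟨fun s => NormedSpace.exp (s • P) (w s),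
    continuous_iff_continuousAt.2 fun t => (hu t).continuousAt⟩, ?_, hu⟩
  simp [hw]

theorem exists_forced_solution {M : ℕ} (h : Fin (M + 1) → ℝ) (n : ℝ) (v₀ : Vec M)
    (g : C(ℝ, Vec M)) :
    ∃ u : C(ℝ, Vec M), u 0 = v₀ ∧ ∀ t, HasDerivAt u (generator h n (u t) + g t) t :=
  exists_linear_ode_solution
    ((Matrix.toEuclideanCLM (n := Fin (M + 1)) (𝕜 := ℂ) (matH h) - (Complex.I * n) •
      Matrix.toEuclideanCLM (n := Fin (M + 1)) (𝕜 := ℂ)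
        (matA M + (1 / (n : ℂ) ^ 2) • matG M)).restrictScalars ℝ) v₀ g

/-- The source term of the `m`-th equation as a function of the coefficients of lower order. -/
def source {M : ℕ} (k : ℝ) (m : ℕ) (F : ∀ l < m, C(ℝ, Vec M)) : C(ℝ, Vec M) where
  toFun t := -((Complex.I / k) • ∑ l : Fin m, if hl : 1 ≤ (l : ℕ) then
    ((1 / ((l : ℕ) : ℂ)) * F l l.isLt t 0) •
      act (matB M) (F (m - l) (by omega) t) else 0)
  continuous_toFun := by
    refine Continuous.neg (Continuous.fun_const_smul (continuous_finsetSum _ fun l _ => ?_) _)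
    split_ifs
    · fun_prop
    · fun_prop

theorem source_apply {M : ℕ} (k : ℝ) (m : ℕ) (F : ℕ → C(ℝ, Vec M)) (t : ℝ) :
    source k m (fun l _ => F l) t = -quadTerm k (fun l => F l) m t := by
  simp only [source, quadTerm, ContinuousMap.coe_mk]
  congr 2
  simp only [dite_eq_ite]
  rw [Fin.sum_univ_eq_sum_range (fun l => if 1 ≤ l then
    ((1 / (l : ℂ)) * F l t 0) • act (matB M) (F (m - l) t) else 0), ← Finset.sum_filter]
  refine Finset.sum_congr ?_ fun _ _ => rfl
  ext l
  simp [and_comm]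

/-- Coefficients of the expansion, defined for all real times. -/
def expansion {M : ℕ} (h : Fin (M + 1) → ℝ) (k : ℝ) (m : ℕ) : C(ℝ, Vec M) :=
  if m = 0 then ContinuousMap.const ℝ (e₁ M)
  else if m = 1 then (exists_forced_solution h k (e₁ M) 0).choose
  else (exists_forced_solution h (m * k) 0
    (source k m fun l _ => expansion h k l)).choose
termination_by m

theorem generator_natCast {M : ℕ} (h : Fin (M + 1) → ℝ) (k : ℝ) (m : ℕ) (v : Vec M) :
    generator h (m * k) v = act (matH h) v
      - (Complex.I * m * k) • act (matA M + (1 / ((m : ℂ) * k) ^ 2) • matG M) v := by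
  unfold generator
  push_cast
  rw [mul_assoc]

theorem isExpansion_expansion {M : ℕ} (h : Fin (M + 1) → ℝ) (k : ℝ) :
    IsExpansion h k fun m => expansion h k m where
  zeroth t _ := by rw [expansion]; simp
  first_init := by
    rw [expansion]
    exact (exists_forced_solution h k (e₁ M) 0).choose_spec.1
  first_order t _ := by
    rw [expansion]
    simpa [generator] using
      ((exists_forced_solution h k (e₁ M) 0).choose_spec.2 t).hasDerivWithinAt (s := Ici 0)
  high_init m hm := by
    rw [expansion, if_neg (by omega), if_neg (by omega)]
    exact (exists_forced_solution h (m * k) 0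
      (source k m fun l _ => expansion h k l)).choose_spec.1
  high_order m hm t _ := by
    rw [← generator_natCast, sub_eq_add_neg, ← source_apply]
    rw [expansion, if_neg (by omega), if_neg (by omega)]
    exact ((exists_forced_solution h (m * k) 0
      (source k m fun l _ => expansion h k l)).choose_spec.2 t).hasDerivWithinAt

/-! ### Geometric growth of the coefficients in `m`. -/

/-- Segner's recurrence with indices shifted by one, to match the convolution in the quadratic term.
-/
theorem sum_catalan_Ico {m : ℕ} (hm : 2 ≤ m) :
    ∑ l ∈ Finset.Ico 1 m, catalan (l - 1) * catalan (m - l - 1) = catalan (m - 1) := by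
  obtain ⟨n, rfl⟩ := Nat.exists_eq_add_of_le' hm
  rw [show n + 2 - 1 = n + 1 by omega, catalan_succ',
    Finset.Nat.sum_antidiagonal_eq_sum_range_succ (fun i j => catalan i * catalan j),
    Finset.sum_Ico_eq_sum_range]
  refine Finset.sum_congr (by congr 1) fun i _ => ?_
  congr 2 <;> omega

theorem catalan_le_four_pow (n : ℕ) : catalan n ≤ 4 ^ n := by
  rw [catalan_eq_centralBinom_div]
  exact (Nat.div_le_self _ _).trans (Nat.centralBinom_le_four_pow n)

/-- The factor `1/l` is bounded by `1`. The added `1` keeps the constant positive, so that it can be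
divided by later. -/
theorem norm_quadTerm_le {M : ℕ} {k : ℝ} (hk : 0 < k) (F : ℕ → ℝ → Vec M) (m : ℕ) (t : ℝ) :
    ‖quadTerm k F m t‖ ≤ (‖Matrix.toEuclideanCLM (n := Fin (M + 1)) (𝕜 := ℂ) (matB M)‖ + 1) / k
      * ∑ l ∈ Finset.Ico 1 m, ‖F l t‖ * ‖F (m - l) t‖ := by
  set β := ‖Matrix.toEuclideanCLM (n := Fin (M + 1)) (𝕜 := ℂ) (matB M)‖ with hβ
  have hterm : ∀ l ∈ Finset.Ico 1 m,
      ‖((1 / (l : ℂ)) * F l t 0) • act (matB M) (F (m - l) t)‖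
        ≤ (β + 1) * (‖F l t‖ * ‖F (m - l) t‖) := by
    intro l hl
    have hl1 : (1 : ℝ) ≤ l := by exact_mod_cast (Finset.mem_Ico.1 hl).1
    have h1 : ‖1 / (l : ℂ)‖ ≤ 1 := by
      rw [norm_div, norm_one, Complex.norm_natCast]
      exact (div_le_one (by linarith)).2 hl1
    have h2 : ‖F l t 0‖ ≤ ‖F l t‖ := PiLp.norm_apply_le _ _
    have h3 : ‖act (matB M) (F (m - l) t)‖ ≤ (β + 1) * ‖F (m - l) t‖ :=
      (ContinuousLinearMap.le_opNorm _ _).trans (by gcongr; linarith)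
    rw [norm_smul, norm_mul]
    calc ‖1 / (l : ℂ)‖ * ‖F l t 0‖ * ‖act (matB M) (F (m - l) t)‖
        ≤ 1 * ‖F l t‖ * ((β + 1) * ‖F (m - l) t‖) := by gcongr
      _ = _ := by ring
  rw [quadTerm, norm_smul]
  have h4 : ‖Complex.I / (k : ℂ)‖ = 1 / k := by
    rw [norm_div, Complex.norm_I, Complex.norm_real, Real.norm_of_nonneg hk.le]
  rw [h4]
  have h5 := (norm_sum_le _ _).trans (Finset.sum_le_sum hterm)
  rw [← Finset.mul_sum] at h5
  calc _ ≤ 1 / k * ((β + 1) * ∑ l ∈ Finset.Ico 1 m, ‖F l t‖ * ‖F (m - l) t‖) := by gcongr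
    _ = _ := by ring

theorem exists_uniform_decay {M : ℕ} {h : Fin (M + 1) → ℝ} (hh : IsFilter h) {k : ℝ}
    (hk : 0 < k) : ∃ lam A r : ℝ, 0 < lam ∧ 0 < A ∧ 0 < r ∧
      (∀ m : ℤ, m ≠ 0 → ∀ z : ℂ,
        Module.End.HasEigenvalue (Matrix.toLin' (matGm h k m)) z → z.re < -lam) ∧
      ∀ F : ℕ → ℝ → Vec M, IsExpansion h k F → ∀ m, 1 ≤ m → ∀ t, 0 ≤ t →
        ‖F m t‖ ≤ A * r ^ m * Real.exp (-lam * t) := by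
  obtain ⟨N, R, lam, C, hlam, hC, hE⟩ := exists_uniform_energy hh hk
  set β := (‖Matrix.toEuclideanCLM (n := Fin (M + 1)) (𝕜 := ℂ) (matB M)‖ + 1) / k with hβ
  have hβ0 : 0 < β := by positivity
  have hC0 : 0 < C := by linarith
  -- With this `K` the bound `(1/K)(KC)^m catalan (m-1)` reproduces itself: the source carries
  -- `β/K²`, solving multiplies by `C/λ`, and `Cβ/(λK²) = 1/K`. At `m = 1` it equals `C`, the bound
  -- for the unforced equation.
  set K := C * β / lam with hK
  have hK0 : 0 < K := by positivity
  -- The rate `lam / 2` also makes the eigenvalue bound `Re z ≤ -lam` strict; the `4` comes from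
  -- `catalan n ≤ 4 ^ n`.
  refine ⟨lam / 2, 1 / K, 4 * (K * C), by positivity, by positivity, by positivity,
    fun m hm z hz => ?_, fun F hF => ?_⟩
  · have hmk : k ≤ |(m : ℝ) * k| := by
      rw [abs_mul, abs_of_pos hk]
      exact le_mul_of_one_le_left hk.le (by exact_mod_cast Int.one_le_abs hm)
    have := eigenvalue_re_le (fun v => hE (m * k) hmk v) hz
    linarith
  have main : ∀ m, 1 ≤ m → ∀ t, 0 ≤ t →
      ‖F m t‖ ≤ 1 / K * (K * C) ^ m * catalan (m - 1) * Real.exp (-(lam / 2) * t) := by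
    intro m
    induction m using Nat.strong_induction_on with
    | _ m ih =>
      intro hm t ht
      rcases hm.eq_or_lt with rfl | hm2
      · have h1 := norm_le_of_forced hlam hC (hE k (le_abs_self k)) (u := F 1) (g := fun _ => 0)
          (b := 0) le_rfl (fun s hs => by simpa [generator] using hF.first_order s hs) (by simp) ht
        have h2 : ‖e₁ M‖ = 1 := by simp [e₁]
        rw [hF.first_init, h2] at h1
        refine h1.trans_eq ?_
        simp
        field_simp
      · have hm2 : 2 ≤ m := hm2
        have hmk : k ≤ |(m : ℝ) * k| := by
          rw [abs_mul, abs_of_pos hk, Nat.abs_cast]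
          exact le_mul_of_one_le_left hk.le (by exact_mod_cast hm)
        set b := β * ((1 / K) ^ 2 * (K * C) ^ m * catalan (m - 1)) with hb
        have hsrc : ∀ s, 0 ≤ s → ‖-quadTerm k F m s‖ ≤ b * Real.exp (-lam * s) := by
          intro s hs
          rw [norm_neg]
          refine (norm_quadTerm_le hk F m s).trans ?_
          have h1 : ∑ l ∈ Finset.Ico 1 m, ‖F l s‖ * ‖F (m - l) s‖ ≤
              ∑ l ∈ Finset.Ico 1 m, (1 / K) ^ 2 * (K * C) ^ m * Real.exp (-lam * s) *
                ((catalan (l - 1) * catalan (m - l - 1) : ℕ) : ℝ) := by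
            refine Finset.sum_le_sum fun l hl => ?_
            obtain ⟨hl1, hlm⟩ := Finset.mem_Ico.1 hl
            refine (mul_le_mul (ih l hlm hl1 s hs) (ih (m - l) (by omega) (by omega) s hs)
              (norm_nonneg _) (by positivity)).trans_eq ?_
            have e1 : Real.exp (-lam * s)
                = Real.exp (-(lam / 2) * s) * Real.exp (-(lam / 2) * s) := by
              rw [← Real.exp_add]; congr 1; ring
            have e2 : (K * C) ^ m = (K * C) ^ l * (K * C) ^ (m - l) := by
              rw [← pow_add]; congr 1; omega
            rw [e1, e2]; push_cast; ring
          rw [← Finset.mul_sum, ← Nat.cast_sum, sum_catalan_Ico hm2] at h1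
          calc _ ≤ β * ((1 / K) ^ 2 * (K * C) ^ m * Real.exp (-lam * s) * catalan (m - 1)) := by
                gcongr
            _ = _ := by ring
        have h1 := norm_le_of_forced hlam hC (hE (m * k) hmk) (u := F m)
          (g := fun s => -quadTerm k F m s) (b := b) (by positivity) (fun s hs => by
            rw [generator_natCast, ← sub_eq_add_neg]
            exact hF.high_order m hm2 s hs) hsrc ht
        rw [hF.high_init m hm2, norm_zero, zero_add] at h1
        refine h1.trans_eq ?_
        rw [hb, hK]
        field_simp
  intro m hm t ht
  refine (main m hm t ht).trans ?_
  have hcat : (catalan (m - 1) : ℝ) ≤ 4 ^ m := by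
    exact_mod_cast (catalan_le_four_pow (m - 1)).trans
      (Nat.pow_le_pow_right (by norm_num) (Nat.sub_le m 1))
  calc _ ≤ 1 / K * (K * C) ^ m * 4 ^ m * Real.exp (-(lam / 2) * t) := by gcongr
    _ = _ := by rw [mul_pow 4]; ring

/-! ### Summation of the series. -/

theorem norm_seriesTerm {M : ℕ} (k ε : ℝ) (F : ℕ → ℝ → Vec M) (x t : ℝ) (m : ℕ) :
    ‖seriesTerm k ε F x t m‖ = |ε| ^ m * ‖F m t‖ := by
  have : ‖Complex.exp (Complex.I * m * k * x)‖ = 1 := by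
    have e : Complex.I * m * k * x = ((m * k * x : ℝ) : ℂ) * Complex.I := by push_cast; ring
    rw [e, Complex.norm_exp_ofReal_mul_I]
  rw [seriesTerm, norm_smul, norm_mul, this, norm_pow, Complex.norm_real, Real.norm_eq_abs, mul_one]

theorem continuous_seriesTerm {M : ℕ} (k ε : ℝ) (F : ℕ → ℝ → Vec M) (t : ℝ) (m : ℕ) :
    Continuous fun x => seriesTerm k ε F x t m := by
  unfold seriesTerm
  fun_prop

end

end FilteredVP

theorem mainTheorem1 (M : ℕ) (D : ℝ) (hD : 0 < D) (h : Fin (M + 1) → ℝ)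
    (hh : FilteredVP.IsFilter h) :
    (∃ F : ℕ → ℝ → FilteredVP.Vec M, FilteredVP.IsExpansion h (FilteredVP.waveNumber D) F) ∧
    ∃ lam C ε₀ : ℝ, 0 < lam ∧ 0 < C ∧ 0 < ε₀ ∧
      (∀ m : ℤ, m ≠ 0 → ∀ z : ℂ,
        Module.End.HasEigenvalue
          (Matrix.toLin' (FilteredVP.matGm h (FilteredVP.waveNumber D) m)) z → z.re < -lam) ∧
      ∀ F : ℕ → ℝ → FilteredVP.Vec M, FilteredVP.IsExpansion h (FilteredVP.waveNumber D) F →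
        ∀ ε : ℝ, |ε| < ε₀ → ∀ t : ℝ, 0 ≤ t →
          (∀ x : ℝ, Summable fun m : ℕ =>
            ‖FilteredVP.seriesTerm (FilteredVP.waveNumber D) ε F x t m‖) ∧
          MemLp (fun x : ℝ => FilteredVP.series (FilteredVP.waveNumber D) ε F x t - F 0 t) 2
            (volume.restrict (Icc 0 D)) ∧
          eLpNorm (fun x : ℝ => FilteredVP.series (FilteredVP.waveNumber D) ε F x t - F 0 t) 2
            (volume.restrict (Icc 0 D))
            ≤ ENNReal.ofReal (C * (t ^ M + 1) * Real.exp (-lam * t)) := by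
  have hk : 0 < FilteredVP.waveNumber D := div_pos Real.two_pi_pos hD
  set k := FilteredVP.waveNumber D
  obtain ⟨lam, A, r, hlam, hA, hr, heig, hdec⟩ := FilteredVP.exists_uniform_decay hh hk
  -- The choice of `ε₀` gives ratio at most `1/2`, so the terms with `m ≥ 1` sum to at most `A
  -- e^(-λt)` uniformly in `x`; `√D` passes from the sup norm to `L²`.
  refine ⟨⟨_, FilteredVP.isExpansion_expansion h k⟩, lam, √D * A, 1 / (2 * r), hlam,
    by positivity, by positivity, heig, fun F hF ε hε t ht => ?_⟩
  have hεr : |ε| * r ≤ 1 / 2 := by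
    have h1 := mul_le_mul_of_nonneg_right hε.le hr.le
    have h2 : 1 / (2 * r) * r = 1 / 2 := by field_simp
    linarith
  have hbound : ∀ x m, ‖FilteredVP.seriesTerm k ε F x t (m + 1)‖
      ≤ A * Real.exp (-lam * t) / 2 * (1 / 2) ^ m := by
    intro x m
    rw [FilteredVP.norm_seriesTerm]
    calc |ε| ^ (m + 1) * ‖F (m + 1) t‖
        ≤ |ε| ^ (m + 1) * (A * r ^ (m + 1) * Real.exp (-lam * t)) := by
          gcongr; exact hdec F hF (m + 1) (by omega) t ht
      _ = A * Real.exp (-lam * t) * (|ε| * r) ^ (m + 1) := by rw [mul_pow]; ring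
      _ ≤ A * Real.exp (-lam * t) * (1 / 2) ^ (m + 1) := by gcongr
      _ = _ := by ring
  have hgeom : HasSum (fun m : ℕ => A * Real.exp (-lam * t) / 2 * (1 / 2) ^ m)
      (A * Real.exp (-lam * t)) := by
    have := hasSum_geometric_two.mul_left (A * Real.exp (-lam * t) / 2)
    rwa [div_mul_cancel₀ _ two_ne_zero] at this
  have hsum : ∀ x, Summable fun m => ‖FilteredVP.seriesTerm k ε F x t m‖ := fun x =>
    (summable_nat_add_iff 1).1
      (Summable.of_nonneg_of_le (fun _ => norm_nonneg _) (hbound x) hgeom.summable)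
  have htail : (fun x => FilteredVP.series k ε F x t - F 0 t)
      = fun x => ∑' m, FilteredVP.seriesTerm k ε F x t (m + 1) := by
    funext x
    rw [FilteredVP.series, (hsum x).of_norm.tsum_eq_zero_add]
    simp [FilteredVP.seriesTerm]
  have hcont : Continuous fun x => FilteredVP.series k ε F x t - F 0 t := by
    rw [htail]
    exact continuous_tsum (fun m => FilteredVP.continuous_seriesTerm k ε F t (m + 1))
      hgeom.summable fun m x => hbound x m
  have hnorm : ∀ x, ‖FilteredVP.series k ε F x t - F 0 t‖ ≤ A * Real.exp (-lam * t) := by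
    intro x
    rw [congrFun htail x]
    exact tsum_of_norm_bounded hgeom (hbound x)
  refine ⟨hsum, MemLp.of_bound hcont.aestronglyMeasurable _ (ae_of_all _ hnorm), ?_⟩
  refine (eLpNorm_le_of_ae_bound (ae_of_all _ hnorm)).trans ?_
  rw [Measure.restrict_apply_univ, Real.volume_Icc, sub_zero,
    ENNReal.ofReal_rpow_of_pos hD, ← ENNReal.ofReal_mul (by positivity)]
  refine ENNReal.ofReal_le_ofReal ?_
  have h1 : D ^ (ENNReal.toReal 2)⁻¹ = √D := by
    rw [Real.sqrt_eq_rpow]; norm_num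
  rw [h1, ← mul_assoc]
  have h2 : 0 ≤ t ^ M := pow_nonneg ht M
  -- The bound holds without the factor `t ^ M + 1`, which only weakens it.
  have h3 : √D * A ≤ √D * A * (t ^ M + 1) := le_mul_of_one_le_right (by positivity) (by linarith)
  gcongr
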